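/- For $\Sigma\subset\mathbb C$ closed, let $\mathcal M(\Sigma)$ be the set of positive Borel measures $\mu$ of finite mass $\|\mu\|$, supported in $\Sigma$, with $\int\log(1+|t|)\,d\mu(t)<\infty$ and finite logarithmic energy $I(\mu)=I(\mu,\mu)<\infty$, where $I(\mu,\nu)=\iint\log\frac1{|x-y|}\,d\mu(x)\,d\nu(y)$; the mutual energy $I$ is extended bilinearly to signed measures. Let $\mathrm{cap}$ denote logarithmic capacity. Let $\Delta=(\Delta_1,\dots,\Delta_d)$ be closed subsets of $\mathbb C$ with $\mathrm{cap}(\Delta_i)>0$ for all $i$ and $\bigcup_i\Delta_i\ne\mathbb C$, and let $K\subset\mathbb R_+^d$ be a non-empty compact set. Let $\mathcal M_K^d(\Delta)$ be the set of $d$-tuples $\mu=(\mu_1,\dots,\mu_d)^t$ with $\mu_i\in\mathcal M(\Delta_i)$ for all $i$ and $\|\mu\|:=(\|\mu_1\|,\dots,\|\mu_d\|)^t\in K$. Let $C=(c_{i,j})\in\mathbb R^{d\times d}$ be symmetric positive semidefinite, with a full-rank factorization $C=B^tB$, $B\in\mathbb R^{r\times d}$, $\operatorname{rank}B=r$. For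 a $d$-tuple $\sigma$ of signed measures put $J(\sigma)=\sum_{i,j=1}^d c_{i,j}\,I(\sigma_i,\sigma_j)$. Let $\mu,\nu\in\mathcal M_K^d(\Delta)$ with $B\|\mu\|=B\|\nu\|$. Then $J(\mu-\nu)$ is finite and $$J(\mu-\nu)\ge 0 .$$ Suppose moreover that no column of $C$ is zero, and that for every $I\subset\{1,\dots,d\}$ which is not a singleton, $$\text{if the columns }(C_i)_{i\in I}\text{ of }C\text{ are linearly dependent, then }\ \mathrm{cap}\Bigl(\bigcap_{i\in I}\Delta_i\Bigr)=0 .$$ Then $J(\mu-\nu)=0$ if and only if $\mu=\nu$. -/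

import Mathlib

open MeasureTheory Matrix
open scoped ENNReal NNReal

noncomputable section

/-- The logarithmic kernel `log (1 / |x - y|)`, with the value `+∞` on the diagonal. -/
def logKernel (x y : ℂ) : EReal := -ENNReal.log (edist x y)

/-- Mutual logarithmic energy `I(μ, ν) = ∬ log (1 / |x - y|) dμ(x) dν(y)` of two positive measures:
the integral of the positive part of the kernel minus the integral of its negative part.
(The second integral is finite whenever `μ` and `ν` are finite and integrate `log (1 + |t|)`.) -/
def mutualEnergy (μ ν : Measure ℂ) : EReal :=
  ((∫⁻ x, ∫⁻ y, (logKernel x y).toENNReal ∂ν ∂μ : ℝ≥0∞) : EReal) -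
    ((∫⁻ x, ∫⁻ y, (-logKernel x y).toENNReal ∂ν ∂μ : ℝ≥0∞) : EReal)

/-- Mutual logarithmic energy of two finite signed measures: the bilinear extension of
`mutualEnergy`, computed on the Jordan decompositions. -/
def signedMutualEnergy (σ τ : SignedMeasure ℂ) : EReal :=
  mutualEnergy σ.toJordanDecomposition.posPart τ.toJordanDecomposition.posPart
    - mutualEnergy σ.toJordanDecomposition.posPart τ.toJordanDecomposition.negPart
    - mutualEnergy σ.toJordanDecomposition.negPart τ.toJordanDecomposition.posPart
    + mutualEnergy σ.toJordanDecomposition.negPart τ.toJordanDecomposition.negPart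

/-- The energy `J(σ) = ∑ i j, c i j * I(σ i, σ j)` of a tuple of signed measures with respect to
the interaction matrix `C`. -/
def vectorEnergy {d : ℕ} (C : Matrix (Fin d) (Fin d) ℝ) (σ : Fin d → SignedMeasure ℂ) : EReal :=
  ∑ i, ∑ j, (C i j : EReal) * signedMutualEnergy (σ i) (σ j)

/-- The tuple of signed measures `μ - ν`. -/
def tupleDiff {d : ℕ} (μ ν : Fin d → FiniteMeasure ℂ) : Fin d → SignedMeasure ℂ :=
  fun i => (μ i : Measure ℂ).toSignedMeasure - (ν i : Measure ℂ).toSignedMeasure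

/-- Logarithmic capacity: the supremum of `exp (-I(μ))` over the Borel probability measures `μ`
carried by a compact subset of `E`. -/
def logCapacity (E : Set ℂ) : ℝ≥0∞ :=
  ⨆ (μ : ProbabilityMeasure ℂ) (_ : ∃ S ⊆ E, IsCompact S ∧ (μ : Measure ℂ) Sᶜ = 0),
    EReal.exp (-mutualEnergy (μ : Measure ℂ) (μ : Measure ℂ))

/-- `𝓜(Σ)`, for closed `Σ`: the finite Borel measures supported in `Σ`, of finite logarithmic
energy, and such that `∫ log (1 + |t|) dμ(t) < ∞`. -/
def energyMeasures (S : Set ℂ) : Set (FiniteMeasure ℂ) :=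
  {μ | (μ : Measure ℂ) Sᶜ = 0 ∧ mutualEnergy (μ : Measure ℂ) (μ : Measure ℂ) < ⊤ ∧
    ∫⁻ t, ENNReal.ofReal (Real.log (1 + ‖t‖)) ∂(μ : Measure ℂ) < ⊤}

/-- The vector of masses `(‖μ₁‖, …, ‖μ_d‖)`. -/
def massVector {d : ℕ} (μ : Fin d → FiniteMeasure ℂ) : Fin d → ℝ :=
  fun i => ((μ i).mass : ℝ)

/-- `𝓜_K^d(Δ)`: the tuples `μ` with `μ i ∈ 𝓜(Δ i)` for all `i` and masses in `K`. -/
def energyTuples {d : ℕ} (Δ : Fin d → Set ℂ) (K : Set (Fin d → ℝ)) :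
    Set (Fin d → FiniteMeasure ℂ) :=
  {μ | (∀ i, μ i ∈ energyMeasures (Δ i)) ∧ massVector μ ∈ K}

/-- For every set `I` of indices that is not a singleton: if the columns `C i`, `i ∈ I`, are
linearly dependent, then the intersection of the `Δ i`, `i ∈ I`, has capacity zero. -/
def DependentColumnsPolar {d : ℕ} (C : Matrix (Fin d) (Fin d) ℝ) (Δ : Fin d → Set ℂ) : Prop :=
  ∀ I : Finset (Fin d), I.card ≠ 1 →
    ¬ LinearIndependent ℝ (fun i : I => C.col (i : Fin d)) →
    logCapacity (⋂ i ∈ I, Δ i) = 0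

end

/-! On signed measures of total mass zero the logarithmic kernel is positive definite, because it is
a superposition of Gaussians: by Frullani, `2 log (1/|x-y|) = ∫₀^∞ (e^{-t|x-y|²} - e^{-t}) dt/t`.
The term `e^{-t}` only sees products of masses and cancels (`sum_realMutualEnergy_eq`). The
remaining Gaussian energies are weighted `L²` norms of the characteristic function
(`sum_gaussEnergy_eq`), hence nonnegative; if the total vanishes, so does the characteristic
function, hence the measure.

Since `C = BᵀB`, `J(σ)` is the sum over the rows `k` of `B` of the energies of `∑ i, B k i σ i`,
which for `σ = μ - ν` have mass zero because `B‖μ‖ = B‖ν‖`. So `J(σ) ≥ 0`, and `J(σ) = 0` forces `Bσ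
= 0` (`vectorEnergy_tupleDiff`).

To deduce `σ = 0`, cut the plane according to the set `I` of indices `i` with `x ∈ Δ i`. On such a
piece only the `σ i` with `i ∈ I` live, and `Cσ = 0` is a linear relation between the columns in
`I`. If these are independent, `σ` vanishes there; otherwise the piece lies in a closed set of
capacity zero, which measures of finite energy do not charge (`eq_of_mulVec_eq_zero`). -/

/-! ### Frullani representation of the logarithmic kernel -/

lemma ofReal_exp_sub_exp_div {a b t : ℝ} (hab : a ≤ b) (ht : 0 < t) :
    ENNReal.ofReal ((Real.exp (-(t * a)) - Real.exp (-(t * b))) / t) =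
      ∫⁻ s in Set.Ioc a b, ENNReal.ofReal (Real.exp (-(t * s))) := by
  have hcont : Continuous fun s : ℝ => Real.exp (-(t * s)) := by fun_prop
  have h : ∫ s in a..b, Real.exp (-(t * s)) =
      (Real.exp (-(t * a)) - Real.exp (-(t * b))) / t := by
    rw [intervalIntegral.integral_eq_sub_of_hasDerivAt (f := fun s => -Real.exp (-(t * s)) / t)]
    · ring
    · intro s _
      have := ((((hasDerivAt_id s).const_mul t).neg).exp.neg).div_const t
      convert! this using 1
      field_simp
      simp
    · exact hcont.intervalIntegrable _ _
  rw [← h, intervalIntegral.integral_of_le hab, ofReal_integral_eq_lintegral_ofReal]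
  · exact (intervalIntegrable_iff_integrableOn_Ioc_of_le hab).1 (hcont.intervalIntegrable _ _)
  · exact Filter.Eventually.of_forall fun s => (Real.exp_pos _).le

lemma lintegral_exp_neg_mul {s : ℝ} (hs : 0 < s) :
    ∫⁻ t in Set.Ioi (0 : ℝ), ENNReal.ofReal (Real.exp (-(t * s))) = ENNReal.ofReal s⁻¹ := by
  have h := integral_exp_mul_Ioi (neg_lt_zero.2 hs) 0
  have hi : IntegrableOn (fun t : ℝ => Real.exp (-(t * s))) (Set.Ioi 0) := by
    refine (integrableOn_exp_mul_Ioi (neg_lt_zero.2 hs) 0).congr_fun (fun t _ => ?_)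
      measurableSet_Ioi
    simp only []
    ring_nf
  rw [← ofReal_integral_eq_lintegral_ofReal hi
    (Filter.Eventually.of_forall fun s => (Real.exp_pos _).le)]
  congr 1
  calc _ = ∫ x in Set.Ioi (0 : ℝ), Real.exp (-s * x) := by
        congr 1; ext t; ring_nf
    _ = _ := by rw [h]; field_simp; simp

/-- Frullani's integral for the exponential, as a lower Lebesgue integral. -/
lemma lintegral_exp_sub_exp_div {a b : ℝ} (ha : 0 ≤ a) (hab : a ≤ b) :
    ∫⁻ t in Set.Ioi (0 : ℝ),
        ENNReal.ofReal ((Real.exp (-(t * a)) - Real.exp (-(t * b))) / t) =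
      ∫⁻ s in Set.Ioc a b, ENNReal.ofReal s⁻¹ := by
  calc _ = ∫⁻ t in Set.Ioi (0 : ℝ), ∫⁻ s in Set.Ioc a b, ENNReal.ofReal (Real.exp (-(t * s))) :=
        setLIntegral_congr_fun measurableSet_Ioi fun t ht => ofReal_exp_sub_exp_div hab ht
    _ = ∫⁻ s in Set.Ioc a b, ∫⁻ t in Set.Ioi (0 : ℝ), ENNReal.ofReal (Real.exp (-(t * s))) :=
        lintegral_lintegral_swap (by fun_prop)
    _ = _ := setLIntegral_congr_fun measurableSet_Ioc fun s hs =>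
        lintegral_exp_neg_mul (ha.trans_lt hs.1)

lemma lintegral_inv_Ioc {a b : ℝ} (ha : 0 < a) (hab : a ≤ b) :
    ∫⁻ s in Set.Ioc a b, ENNReal.ofReal s⁻¹ = ENNReal.ofReal (Real.log (b / a)) := by
  have hi : IntervalIntegrable (fun s : ℝ => s⁻¹) volume a b := by
    refine intervalIntegral.intervalIntegrable_inv (f := fun s => s) (fun x hx => ?_)
      continuousOn_id
    rw [Set.uIcc_of_le hab] at hx
    exact (ha.trans_le hx.1).ne'
  rw [← integral_inv_of_pos ha (ha.trans_le hab), intervalIntegral.integral_of_le hab,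
    ofReal_integral_eq_lintegral_ofReal]
  · exact (intervalIntegrable_iff_integrableOn_Ioc_of_le hab).1 hi
  · filter_upwards [ae_restrict_mem measurableSet_Ioc] with s hs
    exact (inv_pos.2 (ha.trans hs.1)).le

/-- This divergence matches the value `+∞` of the kernel on the diagonal. -/
lemma lintegral_inv_Ioc_zero : ∫⁻ s in Set.Ioc (0 : ℝ) 1, ENNReal.ofReal s⁻¹ = ⊤ := by
  refine ENNReal.eq_top_of_forall_nnreal_le fun r => ?_
  calc (r : ℝ≥0∞) = ENNReal.ofReal (Real.log (1 / Real.exp (-r))) := by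
        simp [Real.exp_neg]
    _ = ∫⁻ s in Set.Ioc (Real.exp (-r)) 1, ENNReal.ofReal s⁻¹ :=
        (lintegral_inv_Ioc (Real.exp_pos _) (by simp)).symm
    _ ≤ _ := lintegral_mono_set (Set.Ioc_subset_Ioc_left (Real.exp_pos _).le)

/-- The integrand of the Frullani representation of `2 * logKernel x y`. -/
noncomputable def frullaniKernel (t : ℝ) (x y : ℂ) : ℝ :=
  (Real.exp (-(t * ‖x - y‖ ^ 2)) - Real.exp (-t)) / t

lemma logKernel_self (x : ℂ) : logKernel x x = ⊤ := by simp [logKernel]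

lemma logKernel_of_ne {x y : ℂ} (h : x ≠ y) :
    logKernel x y = ((-Real.log ‖x - y‖ : ℝ) : EReal) := by
  rw [logKernel, edist_dist, ENNReal.log_ofReal_of_pos (dist_pos.2 h), dist_eq_norm]
  rfl

/-- Frullani between `|x-y|²` and `1`; the square produces the factor 2. For fixed `x, y` the
integrand has the same sign for all `t > 0`, so positive and negative parts can be represented
separately. -/
lemma two_mul_toENNReal_logKernel (x y : ℂ) :
    2 * (logKernel x y).toENNReal =
      ∫⁻ t in Set.Ioi (0 : ℝ), ENNReal.ofReal (frullaniKernel t x y) := by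
  rcases eq_or_ne x y with rfl | hxy
  · have := lintegral_exp_sub_exp_div le_rfl (zero_le_one (α := ℝ))
    rw [lintegral_inv_Ioc_zero] at this
    simpa [logKernel_self, frullaniKernel] using this.symm
  have hpos : 0 < ‖x - y‖ := norm_pos_iff.2 (sub_ne_zero.2 hxy)
  rw [logKernel_of_ne hxy, EReal.real_coe_toENNReal]
  rcases le_total (‖x - y‖) 1 with h | h
  · have := lintegral_exp_sub_exp_div (sq_nonneg ‖x - y‖) (pow_le_one₀ hpos.le h)
    rw [lintegral_inv_Ioc (by positivity) (pow_le_one₀ hpos.le h)] at this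
    simp only [frullaniKernel]
    simp only [mul_one] at this
    rw [this, one_div, Real.log_inv, Real.log_pow, ← ENNReal.ofReal_ofNat 2,
      ← ENNReal.ofReal_mul (by norm_num)]
    congr 1
    push_cast
    ring
  · rw [ENNReal.ofReal_of_nonpos (by simpa using Real.log_nonneg h), mul_zero]
    symm
    rw [setLIntegral_congr_fun (g := fun _ => 0) measurableSet_Ioi, lintegral_zero]
    intro t ht
    refine ENNReal.ofReal_of_nonpos (div_nonpos_of_nonpos_of_nonneg ?_ (le_of_lt ht))
    rw [sub_nonpos, Real.exp_le_exp, neg_le_neg_iff]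
    exact le_mul_of_one_le_right (le_of_lt ht) (one_le_pow₀ h)

lemma two_mul_toENNReal_neg_logKernel (x y : ℂ) :
    2 * (-logKernel x y).toENNReal =
      ∫⁻ t in Set.Ioi (0 : ℝ), ENNReal.ofReal (-frullaniKernel t x y) := by
  have key : ‖x - y‖ ≤ 1 → ∫⁻ t in Set.Ioi (0 : ℝ), ENNReal.ofReal (-frullaniKernel t x y) = 0 := by
    intro h
    rw [setLIntegral_congr_fun (g := fun _ => 0) measurableSet_Ioi, lintegral_zero]
    intro t ht
    refine ENNReal.ofReal_of_nonpos (neg_nonpos.2 (div_nonneg ?_ (le_of_lt ht)))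
    rw [sub_nonneg, Real.exp_le_exp, neg_le_neg_iff]
    exact mul_le_of_le_one_right (le_of_lt ht) (pow_le_one₀ (norm_nonneg _) h)
  rcases eq_or_ne x y with rfl | hxy
  · rw [key (by simp)]
    simp [logKernel_self]
  have hpos : 0 < ‖x - y‖ := norm_pos_iff.2 (sub_ne_zero.2 hxy)
  rw [logKernel_of_ne hxy, ← EReal.coe_neg, EReal.real_coe_toENNReal, neg_neg]
  rcases le_total (‖x - y‖) 1 with h | h
  · rw [key h, ENNReal.ofReal_of_nonpos (Real.log_nonpos hpos.le h), mul_zero]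
  · have := lintegral_exp_sub_exp_div zero_le_one (one_le_pow₀ h (n := 2))
    rw [lintegral_inv_Ioc one_pos (one_le_pow₀ h), div_one, Real.log_pow] at this
    simp only [mul_one] at this
    simp only [frullaniKernel, ← neg_div, neg_sub]
    rw [this, ← ENNReal.ofReal_ofNat 2, ← ENNReal.ofReal_mul (by norm_num)]
    congr 1

lemma measurable_frullaniKernel :
    Measurable fun q : ℝ × ℂ × ℂ => frullaniKernel q.1 q.2.1 q.2.2 := by
  unfold frullaniKernel
  fun_prop

lemma measurable_toENNReal_logKernel :
    Measurable fun p : ℂ × ℂ => (logKernel p.1 p.2).toENNReal := by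
  unfold logKernel
  fun_prop

lemma measurable_toENNReal_neg_logKernel :
    Measurable fun p : ℂ × ℂ => (-logKernel p.1 p.2).toENNReal := by
  unfold logKernel
  fun_prop

/-- The positive and negative parts of the logarithmic kernel are integrable for `μ ⊗ ν`. -/
def FiniteMutualEnergy (μ ν : Measure ℂ) : Prop :=
  ∫⁻ x, ∫⁻ y, (logKernel x y).toENNReal ∂ν ∂μ ≠ ⊤ ∧
    ∫⁻ x, ∫⁻ y, (-logKernel x y).toENNReal ∂ν ∂μ ≠ ⊤

section
variable {μ ν : Measure ℂ} [IsFiniteMeasure μ] [IsFiniteMeasure ν]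

lemma lintegral_ofReal_frullaniKernel :
    ∫⁻ q : ℝ × ℂ × ℂ, ENNReal.ofReal (frullaniKernel q.1 q.2.1 q.2.2)
        ∂((volume.restrict (Set.Ioi 0)).prod (μ.prod ν)) =
      2 * ∫⁻ x, ∫⁻ y, (logKernel x y).toENNReal ∂ν ∂μ := by
  rw [lintegral_prod_symm _ measurable_frullaniKernel.ennreal_ofReal.aemeasurable]
  simp_rw [← two_mul_toENNReal_logKernel]
  rw [lintegral_const_mul _ measurable_toENNReal_logKernel,
    lintegral_prod _ measurable_toENNReal_logKernel.aemeasurable]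

lemma lintegral_ofReal_neg_frullaniKernel :
    ∫⁻ q : ℝ × ℂ × ℂ, ENNReal.ofReal (-frullaniKernel q.1 q.2.1 q.2.2)
        ∂((volume.restrict (Set.Ioi 0)).prod (μ.prod ν)) =
      2 * ∫⁻ x, ∫⁻ y, (-logKernel x y).toENNReal ∂ν ∂μ := by
  have hm : Measurable fun q : ℝ × ℂ × ℂ => ENNReal.ofReal (-frullaniKernel q.1 q.2.1 q.2.2) :=
    measurable_frullaniKernel.neg.ennreal_ofReal
  rw [lintegral_prod_symm _ hm.aemeasurable]
  simp_rw [← two_mul_toENNReal_neg_logKernel]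
  rw [lintegral_const_mul _ measurable_toENNReal_neg_logKernel,
    lintegral_prod _ measurable_toENNReal_neg_logKernel.aemeasurable]

lemma FiniteMutualEnergy.integrable (h : FiniteMutualEnergy μ ν) :
    Integrable (fun q : ℝ × ℂ × ℂ => frullaniKernel q.1 q.2.1 q.2.2)
      ((volume.restrict (Set.Ioi 0)).prod (μ.prod ν)) := by
  refine ⟨measurable_frullaniKernel.aestronglyMeasurable, ?_⟩
  rw [hasFiniteIntegral_iff_norm]
  have : ∀ a : ℝ, ENNReal.ofReal ‖a‖ = ENNReal.ofReal a + ENNReal.ofReal (-a) := by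
    intro a
    rcases le_total 0 a with ha | ha
    · rw [ENNReal.ofReal_of_nonpos (neg_nonpos.2 ha), add_zero, Real.norm_of_nonneg ha]
    · rw [ENNReal.ofReal_of_nonpos ha, zero_add, Real.norm_of_nonpos ha]
  simp_rw [this]
  rw [lintegral_add_left measurable_frullaniKernel.ennreal_ofReal,
    lintegral_ofReal_frullaniKernel, lintegral_ofReal_neg_frullaniKernel]
  exact (ENNReal.add_ne_top.2 ⟨ENNReal.mul_ne_top (by simp) h.1,
    ENNReal.mul_ne_top (by simp) h.2⟩).lt_top

lemma FiniteMutualEnergy.mutualEnergy_eq (h : FiniteMutualEnergy μ ν) :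
    mutualEnergy μ ν = (((∫ t in Set.Ioi (0 : ℝ),
      ∫ p : ℂ × ℂ, frullaniKernel t p.1 p.2 ∂(μ.prod ν)) / 2 : ℝ) : EReal) := by
  rw [← integral_prod _ h.integrable, integral_eq_lintegral_pos_part_sub_lintegral_neg_part
    h.integrable, lintegral_ofReal_frullaniKernel, lintegral_ofReal_neg_frullaniKernel,
    mutualEnergy]
  simp only [ENNReal.toReal_mul, ENNReal.toReal_ofNat]
  rw [← mul_sub, mul_div_cancel_left₀ _ two_ne_zero, EReal.coe_sub,
    EReal.coe_ennreal_toReal h.1, EReal.coe_ennreal_toReal h.2]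

end

/-! ### Gaussian energies and characteristic functions -/

/-- The mutual Gaussian energy of two measures on `ℂ`. -/
noncomputable def gaussEnergy (t : ℝ) (μ ν : Measure ℂ) : ℝ :=
  ∫ p : ℂ × ℂ, Real.exp (-(t * ‖p.1 - p.2‖ ^ 2)) ∂(μ.prod ν)

lemma gaussian_eq_fourier {t : ℝ} (ht : 0 < t) (z : ℂ) :
    ((Real.exp (-(t * ‖z‖ ^ 2)) : ℝ) : ℂ) = ((1 / (4 * Real.pi * t) : ℝ) : ℂ) *
      ∫ ξ : ℂ, (Real.exp (-(‖ξ‖ ^ 2 / (4 * t))) : ℂ) * Complex.exp (inner ℝ z ξ * Complex.I) := by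
  have hb : 0 < ((1 / (4 * t) : ℝ) : ℂ).re := by
    rw [Complex.ofReal_re]; positivity
  have h := GaussianFourier.integral_cexp_neg_mul_sq_norm_add hb Complex.I z
  have h1 : ∀ ξ : ℂ, (Real.exp (-(‖ξ‖ ^ 2 / (4 * t))) : ℂ) * Complex.exp (inner ℝ z ξ * Complex.I)
      = Complex.exp (-((1 / (4 * t) : ℝ) : ℂ) * ‖ξ‖ ^ 2 + Complex.I * (inner ℝ z ξ : ℝ)) := by
    intro ξ
    rw [Complex.exp_add, Complex.ofReal_exp]
    congr 2
    · push_cast; ring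
    · ring
  have ht' : (t : ℂ) ≠ 0 := by exact_mod_cast ht.ne'
  have hpi : (Real.pi : ℂ) ≠ 0 := by exact_mod_cast Real.pi_ne_zero
  simp_rw [h1]
  rw [h, Complex.finrank_real_complex, Complex.I_sq]
  push_cast
  -- The exponent is half the real dimension of `ℂ`, so the normalising factor is `π / (1 / (4t)) =
  -- 4πt`.
  rw [show ((2 : ℂ) / 2) = 1 by norm_num, Complex.cpow_one]
  rw [show (-1 * (‖z‖ : ℂ) ^ 2 / (4 * (1 / (4 * t)))) = -(t * ‖z‖ ^ 2) by field_simp]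
  field_simp

lemma integrable_gaussian_weight {t : ℝ} (ht : 0 < t) :
    Integrable fun ξ : ℂ => Real.exp (-(‖ξ‖ ^ 2 / (4 * t))) := by
  have hb : 0 < ((1 / (4 * t) : ℝ) : ℂ).re := by
    rw [Complex.ofReal_re]; positivity
  have h := (GaussianFourier.integrable_cexp_neg_mul_sq_norm_add hb 0 (0 : ℂ)).norm
  refine h.congr (Filter.Eventually.of_forall fun ξ => ?_)
  simp only [zero_mul, add_zero, Complex.norm_exp]
  congr 1
  rw [← Complex.ofReal_pow, ← Complex.ofReal_neg, ← Complex.ofReal_mul, Complex.ofReal_re]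
  ring

section
variable {μ ν : Measure ℂ} [IsFiniteMeasure μ] [IsFiniteMeasure ν]

lemma integrable_gaussian {t : ℝ} (ht : 0 ≤ t) :
    Integrable (fun p : ℂ × ℂ => Real.exp (-(t * ‖p.1 - p.2‖ ^ 2))) (μ.prod ν) := by
  refine Integrable.of_bound (C := 1) (by fun_prop) (Filter.Eventually.of_forall fun p => ?_)
  rw [Real.norm_of_nonneg (Real.exp_pos _).le, Real.exp_le_one_iff, neg_nonpos]
  positivity

lemma charFun_mul_conj_charFun (ξ : ℂ) :
    charFun μ ξ * (starRingEnd ℂ) (charFun ν ξ) =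
      ∫ p : ℂ × ℂ, Complex.exp (inner ℝ (p.1 - p.2) ξ * Complex.I) ∂(μ.prod ν) := by
  rw [charFun_apply, charFun_apply, ← integral_conj, ← integral_prod_mul]
  congr 1
  ext p
  rw [← Complex.exp_conj, ← Complex.exp_add, inner_sub_left]
  simp only [map_mul, Complex.conj_I, Complex.conj_ofReal]
  push_cast
  ring_nf

lemma ofReal_gaussEnergy {t : ℝ} (ht : 0 < t) :
    (gaussEnergy t μ ν : ℂ) = ((1 / (4 * Real.pi * t) : ℝ) : ℂ) *
      ∫ ξ : ℂ, (Real.exp (-(‖ξ‖ ^ 2 / (4 * t))) : ℂ) *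
        (charFun μ ξ * (starRingEnd ℂ) (charFun ν ξ)) := by
  rw [gaussEnergy, ← integral_complex_ofReal]
  simp_rw [gaussian_eq_fourier ht, charFun_mul_conj_charFun]
  rw [integral_const_mul]
  simp_rw [← integral_const_mul]
  rw [integral_integral_swap]
  have h1 : Integrable (fun q : (ℂ × ℂ) × ℂ => |1 / (4 * Real.pi * t)| *
      Real.exp (-(‖q.2‖ ^ 2 / (4 * t)))) ((μ.prod ν).prod volume) :=
    (integrable_const |1 / (4 * Real.pi * t)|).mul_prod (integrable_gaussian_weight ht)
  refine h1.mono' ?_ (Filter.Eventually.of_forall fun q => ?_)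
  · refine Continuous.aestronglyMeasurable ?_
    simp only [Function.uncurry_def]
    fun_prop
  · simp only [Function.uncurry_def, norm_mul, Complex.norm_exp_ofReal_mul_I, mul_one,
      Complex.norm_real, Real.norm_eq_abs, Real.abs_exp, le_refl]

lemma integrable_gaussian_charFun {t : ℝ} (ht : 0 < t) :
    Integrable fun ξ : ℂ => (Real.exp (-(‖ξ‖ ^ 2 / (4 * t))) : ℂ) *
        (charFun μ ξ * (starRingEnd ℂ) (charFun ν ξ)) := by
  refine (integrable_gaussian_weight ht).ofReal.mul_bdd
    (c := μ.real Set.univ * ν.real Set.univ) ?_ (Filter.Eventually.of_forall fun ξ => ?_)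
  · exact (continuous_charFun.mul (Complex.continuous_conj.comp
      continuous_charFun)).aestronglyMeasurable
  · rw [norm_mul, RCLike.norm_conj]
    exact mul_le_mul (norm_charFun_le _) (norm_charFun_le _) (norm_nonneg _) (by positivity)

end

lemma ofReal_normSq_sum_charFun {ι : Type*} [Fintype ι] {m : ι → Measure ℂ}
    (b : ι → ℝ) (ξ : ℂ) :
    ((‖∑ a, (b a : ℂ) * charFun (m a) ξ‖ ^ 2 : ℝ) : ℂ) =
      ∑ a, ∑ c, ((b a * b c : ℝ) : ℂ) *
        (charFun (m a) ξ * (starRingEnd ℂ) (charFun (m c) ξ)) := by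
  rw [Complex.ofReal_pow, ← Complex.mul_conj', map_sum, Finset.sum_mul_sum]
  refine Finset.sum_congr rfl fun a _ => Finset.sum_congr rfl fun c _ => ?_
  rw [map_mul, Complex.conj_ofReal]
  push_cast
  ring

section
variable {ι : Type*} [Fintype ι] {m : ι → Measure ℂ} [∀ a, IsFiniteMeasure (m a)]

lemma continuous_sum_charFun (b : ι → ℝ) :
    Continuous fun ξ => ∑ a, (b a : ℂ) * charFun (m a) ξ :=
  continuous_finsetSum _ fun _ _ => continuous_const.mul continuous_charFun

lemma integrable_gaussian_normSq {t : ℝ} (ht : 0 < t) (b : ι → ℝ) :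
    Integrable fun ξ : ℂ => Real.exp (-(‖ξ‖ ^ 2 / (4 * t))) *
      ‖∑ a, (b a : ℂ) * charFun (m a) ξ‖ ^ 2 := by
  have h : Integrable fun ξ : ℂ => ∑ a, ∑ c, ((b a * b c : ℝ) : ℂ) *
      ((Real.exp (-(‖ξ‖ ^ 2 / (4 * t))) : ℂ) *
        (charFun (m a) ξ * (starRingEnd ℂ) (charFun (m c) ξ))) :=
    integrable_finsetSum _ fun a _ => integrable_finsetSum _ fun c _ =>
      (integrable_gaussian_charFun ht).const_mul _
  refine h.re.congr (Filter.Eventually.of_forall fun ξ => ?_)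
  have h2 := ofReal_normSq_sum_charFun (m := m) b ξ
  have : ∑ a, ∑ c, ((b a * b c : ℝ) : ℂ) * ((Real.exp (-(‖ξ‖ ^ 2 / (4 * t))) : ℂ) *
        (charFun (m a) ξ * (starRingEnd ℂ) (charFun (m c) ξ))) =
      ((Real.exp (-(‖ξ‖ ^ 2 / (4 * t))) * ‖∑ a, (b a : ℂ) * charFun (m a) ξ‖ ^ 2 : ℝ) : ℂ) := by
    rw [Complex.ofReal_mul, h2, Finset.mul_sum]
    refine Finset.sum_congr rfl fun a _ => ?_
    rw [Finset.mul_sum]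
    exact Finset.sum_congr rfl fun c _ => by ring
  simp only [this]
  exact Complex.ofReal_re _

/-- The Gaussian energy of a linear combination of measures is a weighted `L²` norm of its
characteristic function. -/
lemma sum_gaussEnergy_eq {t : ℝ} (ht : 0 < t) (b : ι → ℝ) :
    ∑ a, ∑ c, b a * b c * gaussEnergy t (m a) (m c) = 1 / (4 * Real.pi * t) *
      ∫ ξ : ℂ, Real.exp (-(‖ξ‖ ^ 2 / (4 * t))) * ‖∑ a, (b a : ℂ) * charFun (m a) ξ‖ ^ 2 := by
  apply Complex.ofReal_injective
  rw [Complex.ofReal_mul, ← integral_complex_ofReal]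
  simp_rw [Complex.ofReal_mul _ (‖_‖ ^ 2), ofReal_normSq_sum_charFun, Finset.mul_sum]
  rw [integral_finsetSum]
  swap
  · intro a _
    refine integrable_finsetSum _ fun c _ => ?_
    refine ((integrable_gaussian_charFun (μ := m a) (ν := m c) ht).const_mul ((b a * b c : ℝ) : ℂ)).congr
      (Filter.Eventually.of_forall fun ξ => ?_)
    simp only []
    ring
  push_cast
  rw [Finset.mul_sum]
  refine Finset.sum_congr rfl fun a _ => ?_
  rw [integral_finsetSum]
  swap
  · intro c _
    refine ((integrable_gaussian_charFun (μ := m a) (ν := m c) ht).const_mul ((b a * b c : ℝ) : ℂ)).congr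
      (Filter.Eventually.of_forall fun ξ => ?_)
    push_cast
    ring
  rw [Finset.mul_sum]
  refine Finset.sum_congr rfl fun c _ => ?_
  rw [ofReal_gaussEnergy ht]
  push_cast
  simp_rw [mul_left_comm _ ((b a : ℂ) * (b c : ℂ))]
  rw [integral_const_mul]
  ring

lemma sum_gaussEnergy_nonneg {t : ℝ} (ht : 0 < t) (b : ι → ℝ) :
    0 ≤ ∑ a, ∑ c, b a * b c * gaussEnergy t (m a) (m c) := by
  rw [sum_gaussEnergy_eq ht]
  refine mul_nonneg (by positivity) (integral_nonneg fun ξ => ?_)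
  positivity

/-- The Gaussian weight is strictly positive, so the combination vanishes almost everywhere, and
everywhere by continuity. -/
lemma sum_charFun_eq_zero {t : ℝ} (ht : 0 < t) (b : ι → ℝ)
    (h : ∑ a, ∑ c, b a * b c * gaussEnergy t (m a) (m c) = 0) (ξ : ℂ) :
    ∑ a, (b a : ℂ) * charFun (m a) ξ = 0 := by
  rw [sum_gaussEnergy_eq ht, mul_eq_zero, or_iff_right (by positivity),
    integral_eq_zero_iff_of_nonneg (fun ξ => by positivity) (integrable_gaussian_normSq ht b)] at h
  have h2 : (fun ξ => ∑ a, (b a : ℂ) * charFun (m a) ξ) =ᵐ[volume] fun _ => 0 := by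
    filter_upwards [h] with ξ hξ
    simpa [(Real.exp_pos _).ne'] using hξ
  exact congr_fun ((Continuous.ae_eq_iff_eq volume (continuous_sum_charFun b)
    continuous_const).1 h2) ξ

lemma charFun_sum_smul (w : ι → ℝ≥0) (ξ : ℂ) :
    charFun (∑ a, w a • m a) ξ = ∑ a, (w a : ℂ) * charFun (m a) ξ := by
  have hint : ∀ a, Integrable (fun x : ℂ => Complex.exp (inner ℝ x ξ * Complex.I)) (m a) := by
    intro a
    refine Integrable.of_bound (C := 1) (by fun_prop) (Filter.Eventually.of_forall fun p => ?_)
    rw [Complex.norm_exp_ofReal_mul_I]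
  rw [charFun_apply, integral_finsetSum_measure fun a _ => (hint a).smul_measure_nnreal]
  refine Finset.sum_congr rfl fun a _ => ?_
  rw [integral_smul_nnreal_measure, charFun_apply]
  rfl

/-- A linear combination of finite measures is determined by its characteristic function. -/
lemma sum_measureReal_eq_zero_of_charFun (b : ι → ℝ)
    (h : ∀ ξ, ∑ a, (b a : ℂ) * charFun (m a) ξ = 0) (A : Set ℂ) :
    ∑ a, b a * (m a).real A = 0 := by
  have hb : ∀ a, b a = (b a).toNNReal - (-b a).toNNReal := fun a => by
    rw [Real.coe_toNNReal', Real.coe_toNNReal', 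
      max_zero_sub_max_neg_zero_eq_self]
  -- Negative coefficients are moved to the other side, so that uniqueness for positive measures
  -- applies.
  have heq : ∑ a, (b a).toNNReal • m a = ∑ a, (-b a).toNNReal • m a := by
    refine Measure.ext_of_charFun (funext fun ξ => ?_)
    rw [charFun_sum_smul, charFun_sum_smul, ← sub_eq_zero, ← Finset.sum_sub_distrib, ← h ξ]
    refine Finset.sum_congr rfl fun a _ => ?_
    conv_rhs => rw [hb a]
    push_cast
    ring
  have hreal : ∀ w : ι → ℝ≥0, (∑ a, w a • m a).real A = ∑ a, (w a : ℝ) * (m a).real A := by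
    intro w
    rw [Measure.real, Measure.finsetSum_apply, ENNReal.toReal_sum]
    · refine Finset.sum_congr rfl fun a _ => ?_
      rw [Measure.smul_apply, ENNReal.smul_def, smul_eq_mul, ENNReal.toReal_mul,
        ENNReal.coe_toReal, Measure.real]
    · intro a _
      exact measure_ne_top _ _
  have h3 := congr_arg (fun η : Measure ℂ => η.real A) heq
  simp only [hreal] at h3
  rw [← sub_eq_zero, ← Finset.sum_sub_distrib] at h3
  rw [← h3]
  refine Finset.sum_congr rfl fun a _ => ?_
  rw [← sub_mul, ← hb a]

end

/-! ### Finiteness of mutual energies -/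

/-- With `lintegral_exp_div_le`, this shows that twice the positive part of the kernel differs by at
most 1 from a superposition of Gaussians over `t > 1`, which is a positive definite kernel and so
allows a Cauchy–Schwarz argument. -/
lemma two_mul_toENNReal_logKernel_le (x y : ℂ) :
    2 * (logKernel x y).toENNReal ≤
      1 + ∫⁻ t in Set.Ioi (1 : ℝ), ENNReal.ofReal (Real.exp (-(t * ‖x - y‖ ^ 2)) / t) := by
  rw [two_mul_toENNReal_logKernel, ← Set.Ioc_union_Ioi_eq_Ioi (zero_le_one (α := ℝ)),
    lintegral_union measurableSet_Ioi (Set.Ioc_disjoint_Ioi le_rfl)]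
  refine add_le_add ?_ (setLIntegral_mono' measurableSet_Ioi fun t ht => ?_)
  -- For small `t` the integrand is at most `(1 - e^{-t})/t ≤ 1`.
  · calc _ ≤ ∫⁻ _ in Set.Ioc (0 : ℝ) 1, 1 := by
          refine setLIntegral_mono' measurableSet_Ioc fun t ht => ?_
          rw [ENNReal.ofReal_le_one, frullaniKernel, div_le_one ht.1]
          have h1 : Real.exp (-(t * ‖x - y‖ ^ 2)) ≤ 1 :=
            Real.exp_le_one_iff.2 (neg_nonpos.2 (mul_nonneg ht.1.le (sq_nonneg _)))
          have h2 := Real.add_one_le_exp (-t)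
          linarith
      _ = 1 := by simp
  · have ht : (1 : ℝ) < t := ht
    refine ENNReal.ofReal_le_ofReal ?_
    rw [frullaniKernel]
    gcongr
    linarith [Real.exp_pos (-t)]

lemma lintegral_exp_div_le (x y : ℂ) :
    ∫⁻ t in Set.Ioi (1 : ℝ), ENNReal.ofReal (Real.exp (-(t * ‖x - y‖ ^ 2)) / t) ≤
      2 * (logKernel x y).toENNReal + 1 := by
  have h1 : ∫⁻ t in Set.Ioi (0 : ℝ), ENNReal.ofReal (Real.exp (-t)) = 1 := by
    simpa using lintegral_exp_neg_mul one_pos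
  rw [two_mul_toENNReal_logKernel, ← h1, ← lintegral_add_right _ (by fun_prop)]
  refine (setLIntegral_mono' measurableSet_Ioi fun t ht => ?_).trans
    (lintegral_mono_set (Set.Ioi_subset_Ioi zero_le_one))
  have ht : (1 : ℝ) < t := ht
  refine le_trans (ENNReal.ofReal_le_ofReal ?_) ENNReal.ofReal_add_le
  rw [frullaniKernel, sub_div]
  have : Real.exp (-t) / t ≤ Real.exp (-t) := div_le_self (Real.exp_pos _).le ht.le
  linarith

/-- Follows from `|x-y| ≤ |x| + |y| ≤ (1+|x|)(1+|y|)`. -/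
lemma toENNReal_neg_logKernel_le (x y : ℂ) :
    (-logKernel x y).toENNReal ≤
      ENNReal.ofReal (Real.log (1 + ‖x‖)) + ENNReal.ofReal (Real.log (1 + ‖y‖)) := by
  rcases eq_or_ne x y with rfl | hxy
  · simp [logKernel_self]
  have hpos : 0 < ‖x - y‖ := norm_pos_iff.2 (sub_ne_zero.2 hxy)
  have hx := norm_nonneg x
  have hy := norm_nonneg y
  rw [logKernel_of_ne hxy, ← EReal.coe_neg, EReal.real_coe_toENNReal, neg_neg,
    ← ENNReal.ofReal_add (Real.log_nonneg (by linarith)) (Real.log_nonneg (by linarith)),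
    ← Real.log_mul (by linarith) (by linarith)]
  refine ENNReal.ofReal_le_ofReal (Real.log_le_log hpos ((norm_sub_le x y).trans ?_))
  nlinarith [mul_nonneg hx hy]

/-- A measure of finite logarithmic energy that integrates `log (1 + |t|)`. -/
def LogAdmissible (μ : Measure ℂ) : Prop :=
  ∫⁻ x, ∫⁻ y, (logKernel x y).toENNReal ∂μ ∂μ ≠ ⊤ ∧
    ∫⁻ t, ENNReal.ofReal (Real.log (1 + ‖t‖)) ∂μ ≠ ⊤

lemma LogAdmissible.mono {μ ν : Measure ℂ} (h : LogAdmissible μ) (hνμ : ν ≤ μ) :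
    LogAdmissible ν :=
  ⟨ne_top_of_le_ne_top h.1 (lintegral_mono' hνμ fun _ => lintegral_mono' hνμ le_rfl),
    ne_top_of_le_ne_top h.2 (lintegral_mono' hνμ le_rfl)⟩

lemma gaussEnergy_nonneg {μ ν : Measure ℂ} (t : ℝ) : 0 ≤ gaussEnergy t μ ν :=
  integral_nonneg fun _ => (Real.exp_pos _).le

lemma lintegral_lintegral_mul_add_const {μ ν : Measure ℂ}
    {f : ℂ → ℂ → ℝ≥0∞} :
    ∫⁻ x, ∫⁻ y, (f x y + 1) ∂ν ∂μ = ∫⁻ x, ∫⁻ y, f x y ∂ν ∂μ + ν Set.univ * μ Set.univ := by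
  simp_rw [lintegral_add_right _ measurable_const]
  simp

lemma lintegral_lintegral_two_mul_logKernel {μ ν : Measure ℂ} :
    ∫⁻ x, ∫⁻ y, 2 * (logKernel x y).toENNReal ∂ν ∂μ =
      2 * ∫⁻ x, ∫⁻ y, (logKernel x y).toENNReal ∂ν ∂μ := by
  have h2 : (2 : ℝ≥0∞) ≠ ⊤ := ENNReal.ofNat_ne_top
  rw [← lintegral_const_mul' _ _ h2]
  exact lintegral_congr fun x => lintegral_const_mul' _ _ h2

section
variable {μ ν : Measure ℂ} [IsFiniteMeasure μ] [IsFiniteMeasure ν]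

@[fun_prop]
lemma measurable_gaussEnergy : Measurable fun t => gaussEnergy t μ ν := by
  have h : StronglyMeasurable fun q : ℝ × ℂ × ℂ => Real.exp (-(q.1 * ‖q.2.1 - q.2.2‖ ^ 2)) :=
    Continuous.stronglyMeasurable (by fun_prop)
  exact (h.integral_prod_right' (ν := μ.prod ν)).measurable

lemma gaussEnergy_comm (t : ℝ) : gaussEnergy t μ ν = gaussEnergy t ν μ := by
  rw [gaussEnergy, gaussEnergy, ← integral_prod_swap]
  simp_rw [Prod.fst_swap, Prod.snd_swap, norm_sub_rev]

/-- Positivity of the Gaussian energy of `μ - ν`. -/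
lemma two_mul_gaussEnergy_le {t : ℝ} (ht : 0 < t) :
    2 * gaussEnergy t μ ν ≤ gaussEnergy t μ μ + gaussEnergy t ν ν := by
  let m : Fin 2 → Measure ℂ := ![μ, ν]
  have : ∀ a, IsFiniteMeasure (m a) := by
    intro a
    fin_cases a
    · exact inferInstanceAs (IsFiniteMeasure μ)
    · exact inferInstanceAs (IsFiniteMeasure ν)
  have h := sum_gaussEnergy_nonneg (m := m) ht ![1, -1]
  simp only [Fin.sum_univ_two, Matrix.cons_val_zero, Matrix.cons_val_one, m] at h
  rw [gaussEnergy_comm (μ := ν) (ν := μ)] at h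
  linarith

lemma lintegral_gaussEnergy_div :
    ∫⁻ t in Set.Ioi (1 : ℝ), ENNReal.ofReal (gaussEnergy t μ ν / t) =
      ∫⁻ x, ∫⁻ y, (∫⁻ t in Set.Ioi (1 : ℝ),
        ENNReal.ofReal (Real.exp (-(t * ‖x - y‖ ^ 2)) / t)) ∂ν ∂μ := by
  have hm : Measurable fun q : (ℂ × ℂ) × ℝ =>
      ENNReal.ofReal (Real.exp (-(q.2 * ‖q.1.1 - q.1.2‖ ^ 2)) / q.2) := by fun_prop
  rw [← lintegral_prod (μ := μ) (ν := ν) (fun p => ∫⁻ t in Set.Ioi (1 : ℝ),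
        ENNReal.ofReal (Real.exp (-(t * ‖p.1 - p.2‖ ^ 2)) / t)) hm.lintegral_prod_right'.aemeasurable,
    lintegral_lintegral_swap hm.aemeasurable]
  refine setLIntegral_congr_fun measurableSet_Ioi fun t ht => ?_
  have ht : (0 : ℝ) < t := zero_lt_one.trans ht
  rw [gaussEnergy, ← integral_div, ofReal_integral_eq_lintegral_ofReal]
  · exact (integrable_gaussian ht.le).div_const t
  · exact Filter.Eventually.of_forall fun p => by positivity

lemma lintegral_gaussEnergy_ne_top_iff :
    ∫⁻ t in Set.Ioi (1 : ℝ), ENNReal.ofReal (gaussEnergy t μ ν / t) ≠ ⊤ ↔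
      ∫⁻ x, ∫⁻ y, (logKernel x y).toENNReal ∂ν ∂μ ≠ ⊤ := by
  have hfin : ν Set.univ * μ Set.univ ≠ ⊤ :=
    ENNReal.mul_ne_top (measure_ne_top _ _) (measure_ne_top _ _)
  rw [lintegral_gaussEnergy_div]
  constructor
  · intro h
    have h1 : 2 * ∫⁻ x, ∫⁻ y, (logKernel x y).toENNReal ∂ν ∂μ ≠ ⊤ := by
      rw [← lintegral_lintegral_two_mul_logKernel]
      refine ne_top_of_le_ne_top ?_ (lintegral_mono fun x => lintegral_mono fun y =>
        (two_mul_toENNReal_logKernel_le x y).trans (add_comm _ _).le)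
      rw [lintegral_lintegral_mul_add_const]
      exact ENNReal.add_ne_top.2 ⟨h, hfin⟩
    exact fun h2 => h1 (by rw [h2]; simp)
  · intro h
    refine ne_top_of_le_ne_top ?_ (lintegral_mono fun x => lintegral_mono fun y =>
        lintegral_exp_div_le x y)
    rw [lintegral_lintegral_mul_add_const, lintegral_lintegral_two_mul_logKernel]
    exact ENNReal.add_ne_top.2 ⟨ENNReal.mul_ne_top (by simp) h, hfin⟩

lemma lintegral_neg_logKernel_ne_top
    (hμ : ∫⁻ t, ENNReal.ofReal (Real.log (1 + ‖t‖)) ∂μ ≠ ⊤)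
    (hν : ∫⁻ t, ENNReal.ofReal (Real.log (1 + ‖t‖)) ∂ν ≠ ⊤) :
    ∫⁻ x, ∫⁻ y, (-logKernel x y).toENNReal ∂ν ∂μ ≠ ⊤ := by
  refine ne_top_of_le_ne_top ?_ (lintegral_mono fun x => lintegral_mono fun y =>
    toENNReal_neg_logKernel_le x y)
  simp_rw [lintegral_add_left measurable_const, lintegral_const]
  rw [lintegral_add_right _ measurable_const, lintegral_const,
    lintegral_mul_const' _ _ (measure_ne_top _ _)]
  exact ENNReal.add_ne_top.2 ⟨ENNReal.mul_ne_top hμ (measure_ne_top _ _),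
    ENNReal.mul_ne_top hν (measure_ne_top _ _)⟩

/-- The logarithmic moments control the negative part. For the positive part, each Gaussian mutual
energy is bounded by the sum of the two self-energies, which are integrable against `dt/t` on `t >
1`. -/
lemma LogAdmissible.finiteMutualEnergy (hμ : LogAdmissible μ) (hν : LogAdmissible ν) :
    FiniteMutualEnergy μ ν := by
  refine ⟨?_, lintegral_neg_logKernel_ne_top hμ.2 hν.2⟩
  rw [← lintegral_gaussEnergy_ne_top_iff]
  refine ne_top_of_le_ne_top (ENNReal.add_ne_top.2 ⟨lintegral_gaussEnergy_ne_top_iff.2 hμ.1,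
    lintegral_gaussEnergy_ne_top_iff.2 hν.1⟩)
    (le_trans ?_ (lintegral_add_left (by fun_prop) _).le)
  refine setLIntegral_mono' measurableSet_Ioi fun t ht => ?_
  have ht : (0 : ℝ) < t := zero_lt_one.trans ht
  rw [← ENNReal.ofReal_add (div_nonneg (gaussEnergy_nonneg t) ht.le)
    (div_nonneg (gaussEnergy_nonneg t) ht.le), ← add_div]
  refine ENNReal.ofReal_le_ofReal ?_
  gcongr
  linarith [two_mul_gaussEnergy_le (μ := μ) (ν := ν) ht, gaussEnergy_nonneg (μ := μ) (ν := ν) t]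

/-- The mutual logarithmic energy of two admissible measures, as a real number. -/
noncomputable def realMutualEnergy (μ ν : Measure ℂ) : ℝ :=
  (∫ t in Set.Ioi (0 : ℝ), ∫ p : ℂ × ℂ, frullaniKernel t p.1 p.2 ∂(μ.prod ν)) / 2

lemma LogAdmissible.mutualEnergy_eq (hμ : LogAdmissible μ) (hν : LogAdmissible ν) :
    mutualEnergy μ ν = (realMutualEnergy μ ν : EReal) :=
  (hμ.finiteMutualEnergy hν).mutualEnergy_eq

lemma integral_frullaniKernel {t : ℝ} (ht : 0 < t) :
    ∫ p : ℂ × ℂ, frullaniKernel t p.1 p.2 ∂(μ.prod ν) =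
      (gaussEnergy t μ ν - Real.exp (-t) * (μ.real Set.univ * ν.real Set.univ)) / t := by
  simp only [frullaniKernel]
  rw [integral_div, integral_sub (integrable_gaussian ht.le) (integrable_const _), gaussEnergy,
    integral_const, smul_eq_mul, ← Set.univ_prod_univ, measureReal_prod_prod]
  ring

end

/-! ### Energy of combinations of total mass zero -/

section
variable {ι : Type*} [Fintype ι] {m : ι → Measure ℂ} [∀ a, IsFiniteMeasure (m a)]

/-- The logarithmic energy of a linear combination of total mass zero is an integral of Gaussian
energies. -/
lemma sum_realMutualEnergy_eq (hm : ∀ a, LogAdmissible (m a)) (b : ι → ℝ)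
    (hb : ∑ a, b a * (m a).real Set.univ = 0) :
    IntegrableOn (fun t => (∑ a, ∑ c, b a * b c * gaussEnergy t (m a) (m c)) / t)
        (Set.Ioi (0 : ℝ)) ∧
      ∑ a, ∑ c, b a * b c * realMutualEnergy (m a) (m c) =
        (∫ t in Set.Ioi (0 : ℝ),
          (∑ a, ∑ c, b a * b c * gaussEnergy t (m a) (m c)) / t) / 2 := by
  have hint : ∀ a c, Integrable (fun t => b a * b c *
      ∫ p : ℂ × ℂ, frullaniKernel t p.1 p.2 ∂((m a).prod (m c)))
      (volume.restrict (Set.Ioi (0 : ℝ))) := fun a c =>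
    (((hm a).finiteMutualEnergy (hm c)).integrable.integral_prod_left).const_mul _
  have hpt : ∀ t ∈ Set.Ioi (0 : ℝ), ∑ a, ∑ c, b a * b c *
      ∫ p : ℂ × ℂ, frullaniKernel t p.1 p.2 ∂((m a).prod (m c)) =
      (∑ a, ∑ c, b a * b c * gaussEnergy t (m a) (m c)) / t := by
    intro t ht
    -- The coefficient of `e^{-t}` is the square of the total mass.
    have h0 : ∑ a, ∑ c, b a * b c * ((m a).real Set.univ * (m c).real Set.univ) = 0 := by
      rw [← mul_zero (∑ a, b a * (m a).real Set.univ), ← hb, Finset.sum_mul_sum]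
      exact Finset.sum_congr rfl fun a _ => Finset.sum_congr rfl fun c _ => by ring
    have h1 : ∑ a, ∑ c, b a * b c * gaussEnergy t (m a) (m c) =
        ∑ a, ∑ c, b a * b c * gaussEnergy t (m a) (m c) - Real.exp (-t) *
          ∑ a, ∑ c, b a * b c * ((m a).real Set.univ * (m c).real Set.univ) := by
      rw [h0]; ring
    rw [h1]
    simp_rw [Finset.mul_sum, ← Finset.sum_sub_distrib, Finset.sum_div, integral_frullaniKernel ht]
    exact Finset.sum_congr rfl fun a _ => Finset.sum_congr rfl fun c _ => by ring
  constructor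
  · exact IntegrableOn.congr_fun (integrable_finsetSum _ fun a _ =>
      integrable_finsetSum _ fun c _ => hint a c) hpt measurableSet_Ioi
  · rw [← setIntegral_congr_fun measurableSet_Ioi hpt, integral_finsetSum _ fun a _ =>
      integrable_finsetSum _ fun c _ => hint a c, Finset.sum_div]
    refine Finset.sum_congr rfl fun a _ => ?_
    rw [integral_finsetSum _ fun c _ => hint a c, Finset.sum_div]
    refine Finset.sum_congr rfl fun c _ => ?_
    rw [integral_const_mul, realMutualEnergy]
    ring

lemma sum_realMutualEnergy_nonneg (hm : ∀ a, LogAdmissible (m a)) (b : ι → ℝ)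
    (hb : ∑ a, b a * (m a).real Set.univ = 0) :
    0 ≤ ∑ a, ∑ c, b a * b c * realMutualEnergy (m a) (m c) := by
  rw [(sum_realMutualEnergy_eq hm b hb).2]
  exact div_nonneg (setIntegral_nonneg measurableSet_Ioi fun t ht =>
    div_nonneg (sum_gaussEnergy_nonneg ht b) (le_of_lt ht)) two_pos.le

lemma sum_measureReal_eq_zero_of_energy (hm : ∀ a, LogAdmissible (m a)) (b : ι → ℝ)
    (hb : ∑ a, b a * (m a).real Set.univ = 0)
    (h : ∑ a, ∑ c, b a * b c * realMutualEnergy (m a) (m c) = 0) (A : Set ℂ) :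
    ∑ a, b a * (m a).real A = 0 := by
  obtain ⟨hint, heq⟩ := sum_realMutualEnergy_eq hm b hb
  rw [heq, div_eq_zero_iff, or_iff_left two_ne_zero, setIntegral_eq_zero_iff_of_nonneg_ae ?_ hint]
    at h
  swap
  · filter_upwards [ae_restrict_mem measurableSet_Ioi] with t ht
    exact div_nonneg (sum_gaussEnergy_nonneg ht b) (le_of_lt ht)
  -- A single `t > 0` with vanishing Gaussian energy suffices, and one exists because the half-line
  -- is not null.
  have hne : (ae (volume.restrict (Set.Ioi (0 : ℝ)))).NeBot := by
    rw [ae_neBot, Ne, Measure.restrict_eq_zero]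
    simp
  obtain ⟨t, ht0, ht⟩ := (h.and (ae_restrict_mem measurableSet_Ioi)).exists
  have ht : (0 : ℝ) < t := ht
  refine sum_measureReal_eq_zero_of_charFun b (sum_charFun_eq_zero ht b ?_) A
  simpa [ht.ne'] using ht0

end

/-! ### Jordan decomposition of a difference -/

/-- Minimality of the Jordan decomposition: where `n` vanishes, `p = μ - ν ≤ μ`, and `p` is carried
there. Hence the Jordan parts of `μ - ν` inherit admissibility from `μ` and `ν`. -/
lemma le_of_mutuallySingular_of_sub_eq {α : Type*} [MeasurableSpace α] {μ ν p n : Measure α}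
    [IsFiniteMeasure μ] [IsFiniteMeasure p] (hs : p ⟂ₘ n)
    (h : ∀ A, MeasurableSet A → p.real A - n.real A = μ.real A - ν.real A) : p ≤ μ := by
  refine Measure.le_iff.2 fun A hA => ?_
  have hA' : MeasurableSet (A ∩ hs.nullSetᶜ) := hA.inter hs.measurableSet_nullSet.compl
  have h1 : p A = p (A ∩ hs.nullSetᶜ) := by
    rw [← measure_inter_add_sdiff A hs.measurableSet_nullSet.compl, Set.sdiff_compl,
      measure_mono_null Set.inter_subset_right hs.measure_nullSet, add_zero]
  have h2 : n.real (A ∩ hs.nullSetᶜ) = 0 := by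
    rw [Measure.real, measure_mono_null Set.inter_subset_right hs.measure_compl_nullSet,
      ENNReal.toReal_zero]
  have h3 := h _ hA'
  have h4 : p.real (A ∩ hs.nullSetᶜ) ≤ μ.real (A ∩ hs.nullSetᶜ) := by
    linarith [measureReal_nonneg (μ := ν) (s := A ∩ hs.nullSetᶜ)]
  rw [h1]
  exact ((ENNReal.toReal_le_toReal (measure_ne_top _ _) (measure_ne_top _ _)).1 h4).trans
    (measure_mono Set.inter_subset_left)

section
variable {μ ν : Measure ℂ} [IsFiniteMeasure μ] [IsFiniteMeasure ν]

lemma jordan_real_sub_real {A : Set ℂ} (hA : MeasurableSet A) :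
    (μ.toSignedMeasure - ν.toSignedMeasure).toJordanDecomposition.posPart.real A -
      (μ.toSignedMeasure - ν.toSignedMeasure).toJordanDecomposition.negPart.real A =
      μ.real A - ν.real A := by
  rw [← SignedMeasure.apply_eq_posPart_real_sub_negPart_real _ hA, _root_.sub_apply,
    Measure.toSignedMeasure_apply_measurable hA, Measure.toSignedMeasure_apply_measurable hA]

lemma jordan_posPart_le :
    (μ.toSignedMeasure - ν.toSignedMeasure).toJordanDecomposition.posPart ≤ μ :=
  le_of_mutuallySingular_of_sub_eq (JordanDecomposition.mutuallySingular _)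
    fun _ hA => jordan_real_sub_real hA

lemma jordan_negPart_le :
    (μ.toSignedMeasure - ν.toSignedMeasure).toJordanDecomposition.negPart ≤ ν :=
  le_of_mutuallySingular_of_sub_eq (ν := μ) (JordanDecomposition.mutuallySingular _).symm
    fun _ hA => by linarith [jordan_real_sub_real (μ := μ) (ν := ν) hA]

end

/-! ### Admissible measures and sets of capacity zero -/

lemma logAdmissible_of_mem_energyMeasures {S : Set ℂ} {μ : FiniteMeasure ℂ}
    (h : μ ∈ energyMeasures S) : LogAdmissible (μ : Measure ℂ) := by
  obtain ⟨-, h1, h2⟩ := h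
  refine ⟨fun htop => ?_, h2.ne⟩
  -- Since `⊤ - ⊤ = ⊥` in `EReal`, an energy below `⊤` bounds the positive part only because the
  -- negative part is finite.
  rw [mutualEnergy, htop, ← EReal.coe_ennreal_toReal (lintegral_neg_logKernel_ne_top h2.ne h2.ne)]
    at h1
  simp at h1

/-- The normalised restriction of `μ` to `S` is a competitor of finite energy. -/
lemma logCapacity_pos_of_isCompact {μ : Measure ℂ} [IsFiniteMeasure μ] (h : LogAdmissible μ)
    {E S : Set ℂ} (hS : IsCompact S) (hSE : S ⊆ E) (hμS : μ S ≠ 0) : 0 < logCapacity E := by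
  have hr : LogAdmissible (μ.restrict S) := h.mono Measure.restrict_le_self
  let P : Measure ℂ := (μ S)⁻¹ • μ.restrict S
  have hP : IsProbabilityMeasure P := ⟨by
    simp [P, ENNReal.inv_mul_cancel hμS (measure_ne_top μ S)]⟩
  have hfin : (μ S)⁻¹ ≠ ⊤ := ENNReal.inv_ne_top.2 hμS
  have hadm : LogAdmissible P := by
    refine ⟨?_, ?_⟩
    · simp only [P, lintegral_smul_measure, smul_eq_mul]
      rw [lintegral_const_mul' _ _ hfin]
      exact ENNReal.mul_ne_top hfin (ENNReal.mul_ne_top hfin hr.1)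
    · simp only [P, lintegral_smul_measure, smul_eq_mul]
      exact ENNReal.mul_ne_top hfin hr.2
  have hSc : P Sᶜ = 0 := by
    simp [P, Measure.restrict_apply hS.measurableSet.compl]
  refine lt_of_lt_of_le ?_ (le_iSup₂_of_le (⟨P, hP⟩ : ProbabilityMeasure ℂ)
    ⟨S, hSE, hS, hSc⟩ le_rfl)
  simp only [ProbabilityMeasure.coe_mk]
  rw [hadm.mutualEnergy_eq hadm, ← EReal.coe_neg, EReal.exp_coe]
  exact ENNReal.ofReal_pos.2 (Real.exp_pos _)

/-- A measure of finite energy does not charge closed sets of capacity zero. -/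
lemma measure_eq_zero_of_logCapacity_eq_zero {μ : Measure ℂ} [IsFiniteMeasure μ]
    (h : LogAdmissible μ) {E : Set ℂ} (hE : IsClosed E) (hcap : logCapacity E = 0) : μ E = 0 := by
  by_contra hne
  obtain ⟨S, hSE, hS, hpos⟩ := hE.measurableSet.exists_lt_isCompact (pos_iff_ne_zero.2 hne)
  exact (logCapacity_pos_of_isCompact h hS hSE hpos.ne').ne' hcap

/-! ### Vector energy and the equality case -/

lemma EReal.coe_finset_sum {α : Type*} (s : Finset α) (f : α → ℝ) :
    ((∑ a ∈ s, f a : ℝ) : EReal) = ∑ a ∈ s, (f a : EReal) := by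
  classical
  induction s using Finset.induction_on with
  | empty => simp
  | insert a s ha ih => rw [Finset.sum_insert ha, Finset.sum_insert ha, EReal.coe_add, ih]

/-- The two summands of `Fin d ⊕ Fin d` index positive and negative Jordan parts; row `k` of `B`,
with opposite signs on them, gives the coefficients of the `k`-th scalar energy. -/
lemma sum_gram_sum {d r : ℕ} (B : Matrix (Fin r) (Fin d) ℝ)
    (E : Fin d ⊕ Fin d → Fin d ⊕ Fin d → ℝ) :
    ∑ i, ∑ j, (Bᵀ * B) i j * (E (.inl i) (.inl j) - E (.inl i) (.inr j) - E (.inr i) (.inl j)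
        + E (.inr i) (.inr j)) =
      ∑ k, ∑ a, ∑ c, Sum.elim (B k) (-B k) a * Sum.elim (B k) (-B k) c * E a c := by
  simp only [Fintype.sum_sum_type, Sum.elim_inl, Sum.elim_inr, Pi.neg_apply, Matrix.mul_apply,
    Matrix.transpose_apply, Finset.sum_mul, ← Finset.sum_add_distrib]
  rw [Finset.sum_congr rfl fun i _ => Finset.sum_comm, Finset.sum_comm]
  refine Finset.sum_congr rfl fun k _ => Finset.sum_congr rfl fun i _ =>
    Finset.sum_congr rfl fun j _ => ?_
  ring

/-- The energy of a difference of tuples of admissible measures with `B ‖μ‖ = B ‖ν‖` is a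
nonnegative real number, and if it vanishes then so does `B (μ - ν)`. -/
lemma vectorEnergy_tupleDiff {d r : ℕ} (B : Matrix (Fin r) (Fin d) ℝ)
    {μ ν : Fin d → FiniteMeasure ℂ}
    (hμ : ∀ i, LogAdmissible (μ i : Measure ℂ)) (hν : ∀ i, LogAdmissible (ν i : Measure ℂ))
    (hmass : B *ᵥ massVector μ = B *ᵥ massVector ν) :
    ∃ q : ℝ, 0 ≤ q ∧ vectorEnergy (Bᵀ * B) (tupleDiff μ ν) = (q : EReal) ∧
      (q = 0 → ∀ A, MeasurableSet A →
        B *ᵥ (fun i => (μ i : Measure ℂ).real A - (ν i : Measure ℂ).real A) = 0) := by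
  let m : Fin d ⊕ Fin d → Measure ℂ :=
    Sum.elim (fun i => (tupleDiff μ ν i).toJordanDecomposition.posPart)
      (fun i => (tupleDiff μ ν i).toJordanDecomposition.negPart)
  have hfin : ∀ a, IsFiniteMeasure (m a) := by
    rintro (i | i)
    · exact inferInstanceAs
        (IsFiniteMeasure (tupleDiff μ ν i).toJordanDecomposition.posPart)
    · exact inferInstanceAs
        (IsFiniteMeasure (tupleDiff μ ν i).toJordanDecomposition.negPart)
  have hm : ∀ a, LogAdmissible (m a) := by
    rintro (i | i)
    · exact (hμ i).mono jordan_posPart_le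
    · exact (hν i).mono jordan_negPart_le
  have hsum : ∀ k A, MeasurableSet A → ∑ a, Sum.elim (B k) (-B k) a * (m a).real A =
      (B *ᵥ (fun i => (μ i : Measure ℂ).real A - (ν i : Measure ℂ).real A)) k := by
    intro k A hA
    simp only [Fintype.sum_sum_type, Sum.elim_inl, Sum.elim_inr, Pi.neg_apply, mulVec, dotProduct,
      ← Finset.sum_add_distrib, m]
    refine Finset.sum_congr rfl fun i _ => ?_
    rw [← jordan_real_sub_real hA, tupleDiff]
    ring
  have hb : ∀ k, ∑ a, Sum.elim (B k) (-B k) a * (m a).real Set.univ = 0 := by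
    intro k
    rw [hsum k _ MeasurableSet.univ]
    have : (fun i => (μ i : Measure ℂ).real Set.univ - (ν i : Measure ℂ).real Set.univ) =
        massVector μ - massVector ν := rfl
    rw [this, mulVec_sub, hmass, sub_self, Pi.zero_apply]
  have hnn : ∀ k, 0 ≤ ∑ a, ∑ c, Sum.elim (B k) (-B k) a * Sum.elim (B k) (-B k) c *
      realMutualEnergy (m a) (m c) := fun k => sum_realMutualEnergy_nonneg hm _ (hb k)
  refine ⟨∑ k, _, Finset.sum_nonneg fun k _ => hnn k, ?_, fun h0 A hA => ?_⟩
  · rw [← sum_gram_sum B fun a c => realMutualEnergy (m a) (m c), vectorEnergy,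
      EReal.coe_finset_sum]
    refine Finset.sum_congr rfl fun i _ => ?_
    rw [EReal.coe_finset_sum]
    refine Finset.sum_congr rfl fun j _ => ?_
    have h := fun a c => (hm a).mutualEnergy_eq (hm c)
    have h1 := h (.inl i) (.inl j)
    have h2 := h (.inl i) (.inr j)
    have h3 := h (.inr i) (.inl j)
    have h4 := h (.inr i) (.inr j)
    simp only [m, Sum.elim_inl, Sum.elim_inr] at h1 h2 h3 h4 ⊢
    rw [signedMutualEnergy, h1, h2, h3, h4]
    push_cast
    rfl
  · ext k
    rw [← hsum k A hA]
    exact sum_measureReal_eq_zero_of_energy hm _ (hb k)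
      ((Finset.sum_eq_zero_iff_of_nonneg fun k _ => hnn k).1 h0 k (Finset.mem_univ k)) A

lemma vectorEnergy_tupleDiff_self {d : ℕ} (C : Matrix (Fin d) (Fin d) ℝ)
    (μ : Fin d → FiniteMeasure ℂ) : vectorEnergy C (tupleDiff μ μ) = 0 := by
  simp [vectorEnergy, tupleDiff, signedMutualEnergy, mutualEnergy,
    SignedMeasure.toJordanDecomposition_zero]

/-- If `B (μ - ν) = 0` and the tuples satisfy the polarity condition, then `μ = ν`. -/
lemma eq_of_mulVec_eq_zero {d r : ℕ} {B : Matrix (Fin r) (Fin d) ℝ} {Δ : Fin d → Set ℂ}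
    (hclosed : ∀ i, IsClosed (Δ i)) {μ ν : Fin d → FiniteMeasure ℂ}
    (hμ : ∀ i, LogAdmissible (μ i : Measure ℂ)) (hν : ∀ i, LogAdmissible (ν i : Measure ℂ))
    (hμΔ : ∀ i, (μ i : Measure ℂ) (Δ i)ᶜ = 0) (hνΔ : ∀ i, (ν i : Measure ℂ) (Δ i)ᶜ = 0)
    (hcol : ∀ i, (Bᵀ * B).col i ≠ 0) (hdep : DependentColumnsPolar (Bᵀ * B) Δ)
    (h : ∀ A, MeasurableSet A →
      B *ᵥ (fun i => (μ i : Measure ℂ).real A - (ν i : Measure ℂ).real A) = 0) : μ = ν := by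
  classical
  -- The fibres of `indexSet` form a finite measurable partition of the plane.
  let indexSet : ℂ → Finset (Fin d) := fun x => Finset.univ.filter fun i => x ∈ Δ i
  have hindex : ∀ I, MeasurableSet (indexSet ⁻¹' {I}) := by
    intro I
    have : indexSet ⁻¹' {I} = ⋂ i, if i ∈ I then Δ i else (Δ i)ᶜ := by
      ext x
      simp only [Set.mem_preimage, Set.mem_singleton_iff, Finset.ext_iff, Finset.mem_filter,
        Finset.mem_univ, true_and, Set.mem_iInter, indexSet]
      refine forall_congr' fun i => ?_
      by_cases hi : i ∈ I <;> simp [hi]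
    rw [this]
    refine MeasurableSet.iInter fun i => ?_
    split_ifs
    · exact (hclosed i).measurableSet
    · exact (hclosed i).measurableSet.compl
  have key : ∀ I A, MeasurableSet A → ∀ i,
      (μ i : Measure ℂ).real (A ∩ indexSet ⁻¹' {I}) -
        (ν i : Measure ℂ).real (A ∩ indexSet ⁻¹' {I}) = 0 := by
    intro I A hA
    have hoff : ∀ i ∉ I, (μ i : Measure ℂ).real (A ∩ indexSet ⁻¹' {I}) -
        (ν i : Measure ℂ).real (A ∩ indexSet ⁻¹' {I}) = 0 := by
      intro i hi
      have hsub : A ∩ indexSet ⁻¹' {I} ⊆ (Δ i)ᶜ := by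
        rintro x ⟨-, rfl⟩ hx
        exact hi (by simpa [indexSet] using hx)
      simp [Measure.real, measure_mono_null hsub (hμΔ i), measure_mono_null hsub (hνΔ i)]
    by_cases hlin : LinearIndependent ℝ fun i : I => (Bᵀ * B).col (i : Fin d)
    · intro i
      by_cases hi : i ∈ I
      swap
      · exact hoff i hi
      have h0 := h _ (hA.inter (hindex I))
      -- Multiplying by `Bᵀ` turns `Bσ = 0` into a relation between columns of `C`. The empty `I`
      -- also falls in this independent case.
      have h1 : (Bᵀ * B) *ᵥ (fun i => (μ i : Measure ℂ).real (A ∩ indexSet ⁻¹' {I}) -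
          (ν i : Measure ℂ).real (A ∩ indexSet ⁻¹' {I})) = 0 := by
        rw [← mulVec_mulVec, h0, mulVec_zero]
      rw [mulVec_eq_sum, ← Finset.sum_subset (Finset.subset_univ I) fun j _ hj => by
        rw [hoff j hj]; simp, ← Finset.sum_coe_sort I] at h1
      simp only [op_smul_eq_smul] at h1
      exact Fintype.linearIndependent_iff.1 hlin (fun j : I =>
        (μ j : Measure ℂ).real (A ∩ indexSet ⁻¹' {I}) - (ν j : Measure ℂ).real (A ∩ indexSet ⁻¹' {I}))
        h1 ⟨i, hi⟩
    -- A single column is independent because it is nonzero.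
    · have hcard : I.card ≠ 1 := by
        rintro hI
        obtain ⟨j, rfl⟩ := Finset.card_eq_one.1 hI
        refine hlin ?_
        have : Unique ({j} : Finset (Fin d)) := inferInstance
        rw [linearIndependent_unique_iff]
        exact hcol _
      have hzero := hdep I hcard hlin
      have hcl : IsClosed (⋂ i ∈ I, Δ i) := isClosed_biInter fun i _ => hclosed i
      have hsub : A ∩ indexSet ⁻¹' {I} ⊆ ⋂ i ∈ I, Δ i := by
        rintro x ⟨-, rfl⟩
        simp [indexSet]
      intro i
      simp [Measure.real,
        measure_mono_null hsub (measure_eq_zero_of_logCapacity_eq_zero (hμ i) hcl hzero),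
        measure_mono_null hsub (measure_eq_zero_of_logCapacity_eq_zero (hν i) hcl hzero)]
  have hsplit : ∀ (η : Measure ℂ) [IsFiniteMeasure η] (A : Set ℂ), MeasurableSet A →
      η.real A = ∑ I, η.real (A ∩ indexSet ⁻¹' {I}) := by
    intro η _ A hA
    rw [← measureReal_biUnion_finset]
    · congr 1
      ext x
      simp
    · intro I _ I' _ hne
      refine Set.disjoint_left.2 ?_
      rintro x ⟨-, rfl⟩ ⟨-, hx⟩
      exact hne hx
    · exact fun I _ => hA.inter (hindex I)
  funext i
  refine FiniteMeasure.toMeasure_injective (Measure.ext fun A hA => ?_)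
  rw [← measureReal_eq_measureReal_iff, ← sub_eq_zero, hsplit _ A hA, hsplit (ν i : Measure ℂ) A hA,
    ← Finset.sum_sub_distrib]
  exact Finset.sum_eq_zero fun I _ => key I A hA i

theorem mainTheorem5 {d r : ℕ} (C : Matrix (Fin d) (Fin d) ℝ) (hC : C.PosSemidef)
    (B : Matrix (Fin r) (Fin d) ℝ) (hCB : C = Bᵀ * B) (hB : B.rank = r)
    (Δ : Fin d → Set ℂ) (hclosed : ∀ i, IsClosed (Δ i)) (hcap : ∀ i, 0 < logCapacity (Δ i))
    (hunion : (⋃ i, Δ i) ≠ Set.univ)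
    (K : Set (Fin d → ℝ)) (hKne : K.Nonempty) (hK : IsCompact K) (hKnonneg : ∀ x ∈ K, ∀ i, 0 ≤ x i)
    (μ ν : Fin d → FiniteMeasure ℂ) (hμ : μ ∈ energyTuples Δ K) (hν : ν ∈ energyTuples Δ K)
    (hmass : B *ᵥ massVector μ = B *ᵥ massVector ν) :
    (0 ≤ vectorEnergy C (tupleDiff μ ν) ∧ vectorEnergy C (tupleDiff μ ν) < ⊤) ∧
      ((∀ i, C.col i ≠ 0) → DependentColumnsPolar C Δ →
        (vectorEnergy C (tupleDiff μ ν) = 0 ↔ μ = ν)) := by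
  subst hCB
  have hμa := fun i => logAdmissible_of_mem_energyMeasures (hμ.1 i)
  have hνa := fun i => logAdmissible_of_mem_energyMeasures (hν.1 i)
  obtain ⟨q, hq, hJ, hzero⟩ := vectorEnergy_tupleDiff B hμa hνa hmass
  refine ⟨⟨?_, ?_⟩, fun hcol hdep => ⟨fun h0 => ?_, ?_⟩⟩
  · rw [hJ]
    exact_mod_cast hq
  · rw [hJ]
    exact EReal.coe_lt_top q
  · rw [hJ] at h0
    exact eq_of_mulVec_eq_zero hclosed hμa hνa (fun i => (hμ.1 i).1) (fun i => (hν.1 i).1)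
      hcol hdep (hzero (by exact_mod_cast h0))
  · rintro rfl
    exact vectorEnergy_tupleDiff_self _ μ
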